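/- Let $N,M\ge 1$ be integers and let $q:\mathbb Z^2\to\mathbb R$ be $(N,M)$-periodic, i.e. $q_{n+N,m}=q_{n,m}$ and $q_{n,m+M}=q_{n,m}$ for all $n,m\in\mathbb Z$. Let $\mathcal J_1$ be the discrete Schrödinger operator on the complex Hilbert space $\ell^2(\mathbb Z^2)$, the bounded self-adjoint operator given by $$(\mathcal J_1y)_{n,m}=y_{n,m-1}+y_{n,m+1}+y_{n-1,m}+y_{n+1,m}+q_{n,m}y_{n,m},\qquad n,m\in\mathbb Z.$$ Then the Lebesgue measure of its spectrum $\sigma(\mathcal J_1)\subset\mathbb R$ satisfies $$\operatorname{mes}(\sigma(\mathcal J_1))\le 4(N+M).$$ Moreover, for $N=M=1$ and $q$ constant, equality holds: $\operatorname{mes}(\sigma(\mathcal J_1))=8=4(1+1)$. -/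

import Mathlib

open scoped ENNReal

noncomputable section

namespace DiscreteSchrodinger

/-- The complex Hilbert space `ℓ²(ℤ²)`. -/
abbrev L2 : Type := lp (fun _ : ℤ × ℤ => ℂ) 2

/-- `q` is `(N, M)`-periodic: it has period `N` in the first variable and period `M` in the
second one. -/
def IsPeriodic (N M : ℕ) (q : ℤ → ℤ → ℝ) : Prop :=
  (∀ n m : ℤ, q (n + N) m = q n m) ∧ (∀ n m : ℤ, q n (m + M) = q n m)

/-- `q` is a bounded sequence. -/
def IsBoundedSeq (q : ℤ → ℤ → ℝ) : Prop := ∃ C : ℝ, ∀ n m : ℤ, |q n m| ≤ C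

theorem IsPeriodic.isBoundedSeq {N M : ℕ} {q : ℤ → ℤ → ℝ} (hq : IsPeriodic N M q)
    (hN : 0 < N) (hM : 0 < M) : IsBoundedSeq q := by
  have hN' : (0 : ℤ) < N := by exact_mod_cast hN
  have hM' : (0 : ℤ) < M := by exact_mod_cast hM
  have h1 : ∀ n m : ℤ, q (n % N) m = q n m := fun n m => by
    have hp : Function.Periodic (fun n => q n m) (N : ℤ) := fun n => hq.1 n m
    have h := hp.sub_zsmul_eq (x := n) (n / N)
    simp only [smul_eq_mul] at h
    rw [Int.emod_def, mul_comm]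
    exact h
  have h2 : ∀ n m : ℤ, q n (m % M) = q n m := fun n m => by
    have hp : Function.Periodic (fun m => q n m) (M : ℤ) := fun m => hq.2 n m
    have h := hp.sub_zsmul_eq (x := m) (m / M)
    simp only [smul_eq_mul] at h
    rw [Int.emod_def, mul_comm]
    exact h
  refine ⟨∑ i ∈ Finset.Ico (0 : ℤ) N ×ˢ Finset.Ico (0 : ℤ) M, |q i.1 i.2|, fun n m => ?_⟩
  have hmem : (n % (N : ℤ), m % (M : ℤ)) ∈ Finset.Ico (0 : ℤ) N ×ˢ Finset.Ico (0 : ℤ) M := by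
    simp only [Finset.mem_product, Finset.mem_Ico]
    exact ⟨⟨Int.emod_nonneg _ hN'.ne', Int.emod_lt_of_pos _ hN'⟩,
      ⟨Int.emod_nonneg _ hM'.ne', Int.emod_lt_of_pos _ hM'⟩⟩
  have h := Finset.single_le_sum (f := fun i : ℤ × ℤ => |q i.1 i.2|)
    (fun i _ => abs_nonneg _) hmem
  simpa only [h1, h2] using h

theorem summable_sq (u : L2) : Summable fun p : ℤ × ℤ => ‖u p‖ ^ (2 : ℕ) := by
  have h := (memℓp_gen_iff (p := (2 : ℝ≥0∞)) (by norm_num)).1 (lp.memℓp u)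
  simpa using h

theorem memℓp_two {f : ℤ × ℤ → ℂ} (h : Summable fun p => ‖f p‖ ^ (2 : ℕ)) :
    Memℓp (E := fun _ : ℤ × ℤ => ℂ) f 2 := by
  refine (memℓp_gen_iff (p := (2 : ℝ≥0∞)) (by norm_num)).2 ?_
  simpa using h

theorem norm_sq_eq (u : L2) : ‖u‖ ^ (2 : ℕ) = ∑' p : ℤ × ℤ, ‖u p‖ ^ (2 : ℕ) := by
  have h := lp.norm_rpow_eq_tsum (p := (2 : ℝ≥0∞)) (by norm_num) u
  simpa using h

/-- The translation `(shift a u)(p) = u (p + a)` on `ℓ²(ℤ²)`. -/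
def shift (a : ℤ × ℤ) : L2 →L[ℂ] L2 :=
  LinearMap.mkContinuous
    { toFun := fun u => ⟨fun p => u (p + a),
        memℓp_two ((Equiv.addRight a).summable_iff.2 (summable_sq u))⟩
      map_add' := fun _ _ => rfl
      map_smul' := fun _ _ => rfl } 1 (by
    intro u
    rw [one_mul]
    refine (sq_le_sq₀ (norm_nonneg _) (norm_nonneg _)).1 (le_of_eq ?_)
    rw [norm_sq_eq, norm_sq_eq]
    exact (Equiv.addRight a).tsum_eq (fun p => ‖u p‖ ^ (2 : ℕ)))

theorem summable_mul {q : ℤ → ℤ → ℝ} {C : ℝ} (hC : ∀ n m : ℤ, |q n m| ≤ C) (u : L2) :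
    (∀ p : ℤ × ℤ, ‖(q p.1 p.2 : ℂ) * u p‖ ^ (2 : ℕ) ≤ C ^ 2 * ‖u p‖ ^ (2 : ℕ)) ∧
      Summable fun p : ℤ × ℤ => ‖(q p.1 p.2 : ℂ) * u p‖ ^ (2 : ℕ) := by
  have key : ∀ p : ℤ × ℤ, ‖(q p.1 p.2 : ℂ) * u p‖ ^ (2 : ℕ) ≤ C ^ 2 * ‖u p‖ ^ (2 : ℕ) := by
    intro p
    rw [norm_mul, mul_pow, Complex.norm_real, Real.norm_eq_abs]
    gcongr
    exact hC _ _
  exact ⟨key, Summable.of_nonneg_of_le (fun _ => by positivity) key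
    ((summable_sq u).mul_left _)⟩

/-- Multiplication by a bounded real sequence `q` on `ℓ²(ℤ²)`. -/
def mulOp (q : ℤ → ℤ → ℝ) (hq : IsBoundedSeq q) : L2 →L[ℂ] L2 :=
  LinearMap.mkContinuousOfExistsBound
    { toFun := fun u => ⟨fun p => (q p.1 p.2 : ℂ) * u p,
        memℓp_two (summable_mul hq.choose_spec u).2⟩
      map_add' := fun u v => by
        ext p
        exact mul_add _ _ _
      map_smul' := fun c u => by
        ext p
        exact mul_left_comm _ _ _ } (by
    obtain ⟨C, hC⟩ := hq
    have hC0 : 0 ≤ C := (abs_nonneg _).trans (hC 0 0)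
    refine ⟨C, fun u => ?_⟩
    refine (sq_le_sq₀ (norm_nonneg _) (by positivity)).1 ?_
    rw [mul_pow, norm_sq_eq, norm_sq_eq, ← tsum_mul_left]
    exact (summable_mul hC u).2.tsum_le_tsum (summable_mul hC u).1
      ((summable_sq u).mul_left _))

/-- The two-dimensional discrete Schrödinger operator with bounded real potential `q`, as a
bounded operator on `ℓ²(ℤ²)`. -/
def schrodinger (q : ℤ → ℤ → ℝ) (hq : IsBoundedSeq q) : L2 →L[ℂ] L2 :=
  shift (0, -1) + shift (0, 1) + shift (-1, 0) + shift (1, 0) + mulOp q hq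

/-- The pointwise formula for the operator. -/
theorem schrodinger_apply (q : ℤ → ℤ → ℝ) (hq : IsBoundedSeq q) (u : L2) (n m : ℤ) :
    schrodinger q hq u (n, m) =
      u (n, m - 1) + u (n, m + 1) + u (n - 1, m) + u (n + 1, m) + (q n m : ℂ) * u (n, m) := by
  have h : schrodinger q hq u (n, m) =
      u ((n, m) + (0, -1)) + u ((n, m) + (0, 1)) + u ((n, m) + (-1, 0)) + u ((n, m) + (1, 0)) +
        (q n m : ℂ) * u (n, m) := rfl
  rw [h]
  simp only [Prod.mk_add_mk, add_zero, sub_eq_add_neg]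

/-- The operator is symmetric, hence self-adjoint, so that its spectrum is a set of reals. -/
theorem schrodinger_isSelfAdjoint (q : ℤ → ℤ → ℝ) (hq : IsBoundedSeq q) :
    IsSelfAdjoint (schrodinger q hq) := by
  have hs : ∀ (a : ℤ × ℤ) (u v : L2), inner ℂ (shift a u) v = inner ℂ u (shift (-a) v) := by
    intro a u v
    rw [lp.inner_eq_tsum, lp.inner_eq_tsum,
      ← (Equiv.addRight a).tsum_eq (fun p => inner ℂ (u p) (shift (-a) v p))]
    refine tsum_congr fun p => ?_
    have h : shift (-a) v (p + a) = v (p + a + -a) := rfl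
    change inner ℂ (u (p + a)) (v p) = inner ℂ (u (p + a)) (shift (-a) v (p + a))
    rw [h, add_neg_cancel_right]
  have hm : ∀ u v : L2, inner ℂ (mulOp q hq u) v = inner ℂ u (mulOp q hq v) := by
    intro u v
    rw [lp.inner_eq_tsum, lp.inner_eq_tsum]
    refine tsum_congr fun p => ?_
    change inner ℂ ((q p.1 p.2 : ℂ) * u p) (v p) = inner ℂ (u p) ((q p.1 p.2 : ℂ) * v p)
    simp only [RCLike.inner_apply, map_mul, Complex.conj_ofReal]
    ring
  rw [ContinuousLinearMap.isSelfAdjoint_iff_isSymmetric]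
  intro u v
  change inner ℂ (schrodinger q hq u) v = inner ℂ u (schrodinger q hq v)
  simp only [schrodinger, add_apply, inner_add_left, inner_add_right, hs, hm,
    Prod.neg_mk, neg_neg, neg_zero]
  ring

/-- The spectrum of a (self-adjoint) bounded operator on `ℓ²(ℤ²)`, as a subset of `ℝ`. -/
def realSpectrum (T : L2 →L[ℂ] L2) : Set ℝ := {x : ℝ | (x : ℂ) ∈ spectrum ℂ T}

end DiscreteSchrodinger

end

/-! ### Invertibility criteria for self-adjoint operators. -/

namespace DiscreteSchrodinger

open scoped InnerProductSpace

/-! Cut `ℤ²` into `N × M` cells. A coupling `Re (u (p+e) * conj (u p))` across a cell wall lies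
between `±(‖u p‖² + ‖u (p+e)‖²) / 2`. Replacing all such couplings by these bounds traps the
quadratic form of the operator `J` between two decoupled forms. By periodicity, each of these is an
orthogonal sum of copies of one Hermitian matrix on a single cell, `A` (below, `σ = -1`) or `B`
(above, `σ = 1`).

Let `α i ≤ β i` be the eigenvalues of `A` and `B`, paired in decreasing order. If `x` lies in no `[α
i, β i]`, the eigenvectors of `B` with `β i < x` and those of `A` with `x < α i` span complementary
subspaces of the cell space (`exists_splitting`). Cell by cell, this splits `ℓ²` into a part where
`J - x ≤ -ε` and a part where `J - x ≥ ε`, so `J - x` is invertible (`isUnit_of_forall_exists_add`).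
Hence the spectrum lies in the union of the `[α i, β i]` (`realSpectrum_subset`), of total length
`tr B - tr A`. This is twice the number `2(N+M)` of steps leaving a cell.

For a constant potential `c`, damped plane waves are approximate eigenvectors for every point of
`[c-4, c+4]`, an interval of length 8 (`Icc_subset_realSpectrum`). -/

theorem isUnit_of_antilipschitz_of_isSelfAdjoint {H : Type*} [NormedAddCommGroup H]
    [InnerProductSpace ℂ H] [CompleteSpace H] {T : H →L[ℂ] H} (hT : IsSelfAdjoint T) {c : ℝ}
    (hc : 0 < c) (h : ∀ u, c * ‖u‖ ≤ ‖T u‖) : IsUnit T := by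
  have hanti : AntilipschitzWith (Real.toNNReal c⁻¹) T := by
    refine T.antilipschitz_of_bound fun u => ?_
    rw [Real.coe_toNNReal _ (by positivity), inv_mul_eq_div, le_div_iff₀ hc, mul_comm]
    exact h u
  rw [ContinuousLinearMap.isUnit_iff_bijective,
    ContinuousLinearMap.bijective_iff_dense_range_and_antilipschitz]
  refine ⟨?_, _, hanti⟩
  rw [Submodule.topologicalClosure_eq_top_iff, Submodule.eq_bot_iff]
  intro u hu
  -- A vector orthogonal to the range is orthogonal to `T (T u)`, so `‖T u‖² = 0` by symmetry.
  have hTu : T u = 0 := by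
    have h0 := (Submodule.mem_orthogonal _ _).1 hu (T (T u)) ⟨T u, rfl⟩
    have hs := (ContinuousLinearMap.isSelfAdjoint_iff_isSymmetric.1 hT) (T u) u
    change ⟪T (T u), u⟫_ℂ = ⟪T u, T u⟫_ℂ at hs
    rw [h0] at hs
    exact inner_self_eq_zero.1 hs.symm
  have := h u
  rw [hTu, norm_zero] at this
  exact norm_le_zero_iff.1 (by nlinarith [norm_nonneg u])

/-- A self-adjoint operator which is uniformly negative on the first and uniformly positive on the
second part of a decomposition of every vector is invertible. -/
theorem isUnit_of_forall_exists_add {H : Type*} [NormedAddCommGroup H]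
    [InnerProductSpace ℂ H] [CompleteSpace H] {T : H →L[ℂ] H} (hT : IsSelfAdjoint T) {ε : ℝ}
    (hε : 0 < ε) (h : ∀ u, ∃ v w, u = v + w ∧ (⟪v, T v⟫_ℂ).re ≤ -(ε * ‖v‖ ^ 2) ∧
      ε * ‖w‖ ^ 2 ≤ (⟪w, T w⟫_ℂ).re) : IsUnit T := by
  refine isUnit_of_antilipschitz_of_isSelfAdjoint hT (half_pos hε) fun u => ?_
  obtain ⟨v, w, rfl, hv, hw⟩ := h u
  have hcross : (⟪w, T v⟫_ℂ).re = (⟪v, T w⟫_ℂ).re := by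
    have hs := (ContinuousLinearMap.isSelfAdjoint_iff_isSymmetric.1 hT) w v
    change ⟪T w, v⟫_ℂ = ⟪w, T v⟫_ℂ at hs
    rw [← hs, ← inner_conj_symm, Complex.conj_re]
  -- Testing against `w - v` cancels the cross terms and leaves at least `ε (‖v‖² + ‖w‖²) ≥ (ε/2)
  -- (‖v‖ + ‖w‖)²`, whence the constant `ε / 2`.
  have h1 : (⟪w - v, T (v + w)⟫_ℂ).re = (⟪w, T w⟫_ℂ).re - (⟪v, T v⟫_ℂ).re := by
    simp only [map_add, inner_sub_left, inner_add_right, Complex.add_re, Complex.sub_re, hcross]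
    ring
  have h2 : (⟪w - v, T (v + w)⟫_ℂ).re ≤ (‖v‖ + ‖w‖) * ‖T (v + w)‖ := by
    refine (Complex.re_le_norm _).trans ((norm_inner_le_norm _ _).trans ?_)
    gcongr
    rw [add_comm]
    exact norm_sub_le w v
  have h3 := norm_add_le v w
  have h4 : (‖v‖ + ‖w‖) * (ε / 2 * (‖v‖ + ‖w‖)) ≤ (‖v‖ + ‖w‖) * ‖T (v + w)‖ := by
    nlinarith [mul_nonneg hε.le (sq_nonneg (‖v‖ - ‖w‖))]
  rcases (add_nonneg (norm_nonneg v) (norm_nonneg w)).eq_or_lt with h0 | h0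
  · rw [← h0] at h3
    have := mul_nonpos_of_nonneg_of_nonpos (half_pos hε).le h3
    exact this.trans (norm_nonneg _)
  · exact (mul_le_mul_of_nonneg_left h3 (half_pos hε).le).trans (le_of_mul_le_mul_left h4 h0)

/-! ### Comparison of two ordered forms through their eigenbases. -/

section FiniteDimensional

variable {ι E : Type*} [Fintype ι] [NormedAddCommGroup E] [InnerProductSpace ℂ E]

theorem repr_eq_zero_of_mem_span (b : OrthonormalBasis ι ℂ E) {s : Set ι} {x : E}
    (hx : x ∈ Submodule.span ℂ (b '' s)) {i : ι} (hi : i ∉ s) : b.repr x i = 0 := by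
  classical
  induction hx using Submodule.span_induction with
  | mem x h =>
    obtain ⟨j, hj, rfl⟩ := h
    have hij : i ≠ j := fun h => hi (h ▸ hj)
    simp [hij]
  | zero => simp
  | add x y _ _ hx hy => simp [hx, hy]
  | smul c x _ hx => simp [hx]

theorem re_inner_eq_sum (b : OrthonormalBasis ι ℂ E) {B : E →ₗ[ℂ] E} {β : ι → ℝ}
    (hB : ∀ i, B (b i) = (β i : ℂ) • b i) (x : E) :
    (⟪x, B x⟫_ℂ).re = ∑ i, β i * ‖b.repr x i‖ ^ 2 := by
  have h1 : B x = ∑ i, (β i * b.repr x i : ℂ) • b i := by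
    conv_lhs => rw [← b.sum_repr x]
    simp only [map_sum, map_smul, hB, smul_smul]
    exact Finset.sum_congr rfl fun i _ => by rw [mul_comm]
  rw [h1, inner_sum, Complex.re_sum]
  refine Finset.sum_congr rfl fun i _ => ?_
  have h2 : ⟪x, b i⟫_ℂ = (starRingEnd ℂ) (b.repr x i) := by
    rw [b.repr_apply_apply, inner_conj_symm]
  rw [inner_smul_right, h2, mul_assoc, Complex.mul_conj, Complex.normSq_eq_norm_sq,
    ← Complex.ofReal_mul, Complex.ofReal_re]

theorem re_inner_le_of_mem_span (b : OrthonormalBasis ι ℂ E) {B : E →ₗ[ℂ] E} {β : ι → ℝ}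
    (hB : ∀ i, B (b i) = (β i : ℂ) • b i) {s : Set ι} {μ : ℝ} (hs : ∀ i ∈ s, β i ≤ μ) {x : E}
    (hx : x ∈ Submodule.span ℂ (b '' s)) : (⟪x, B x⟫_ℂ).re ≤ μ * ‖x‖ ^ 2 := by
  rw [re_inner_eq_sum b hB, ← b.repr.norm_map x, EuclideanSpace.norm_sq_eq, Finset.mul_sum]
  refine Finset.sum_le_sum fun i _ => ?_
  by_cases hi : i ∈ s
  · exact mul_le_mul_of_nonneg_right (hs i hi) (by positivity)
  · simp [repr_eq_zero_of_mem_span b hx hi]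

theorem le_re_inner_of_mem_span (b : OrthonormalBasis ι ℂ E) {B : E →ₗ[ℂ] E} {β : ι → ℝ}
    (hB : ∀ i, B (b i) = (β i : ℂ) • b i) {s : Set ι} {μ : ℝ} (hs : ∀ i ∈ s, μ ≤ β i) {x : E}
    (hx : x ∈ Submodule.span ℂ (b '' s)) : μ * ‖x‖ ^ 2 ≤ (⟪x, B x⟫_ℂ).re := by
  have h := re_inner_le_of_mem_span b (B := -B) (β := fun i => -β i) (μ := -μ)
    (fun i => by simp [hB]) (fun i hi => neg_le_neg (hs i hi)) hx
  simp only [LinearMap.neg_apply, inner_neg_right, Complex.neg_re] at h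
  linarith

variable {A B : E →ₗ[ℂ] E} {a b : OrthonormalBasis ι ℂ E} {α β : ι → ℝ}

/-- A common vector would satisfy `ν‖x‖² ≤ ⟪x, A x⟫ ≤ ⟪x, B x⟫ ≤ μ‖x‖²`, which forces `x = 0`. -/
theorem disjoint_span_of_lt (hA : ∀ i, A (a i) = (α i : ℂ) • a i)
    (hB : ∀ i, B (b i) = (β i : ℂ) • b i)
    (hAB : ∀ x, (⟪x, A x⟫_ℂ).re ≤ (⟪x, B x⟫_ℂ).re) {s t : Set ι} {μ ν : ℝ} (hμν : μ < ν)
    (hs : ∀ i ∈ s, β i ≤ μ) (ht : ∀ i ∈ t, ν ≤ α i) :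
    Disjoint (Submodule.span ℂ (b '' s)) (Submodule.span ℂ (a '' t)) := by
  rw [Submodule.disjoint_def]
  intro x hx hx'
  have h1 := re_inner_le_of_mem_span b hB hs hx
  have h2 := le_re_inner_of_mem_span a hA ht hx'
  have h3 := hAB x
  have h4 : ‖x‖ ^ 2 ≤ 0 := by nlinarith [sq_nonneg ‖x‖]
  exact norm_eq_zero.1 (pow_eq_zero_iff two_ne_zero |>.1 (le_antisymm h4 (sq_nonneg _)))

theorem finrank_span_image (b : OrthonormalBasis ι ℂ E) (s : Finset ι) :
    Module.finrank ℂ (Submodule.span ℂ (b '' (s : Set ι))) = s.card := by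
  classical
  have h := finrank_span_finset_eq_card (R := ℂ) (s := s.image b) ?_
  · rw [Finset.card_image_of_injective _ b.orthonormal.linearIndependent.injective] at h
    rwa [Finset.coe_image] at h
  · have := (b.orthonormal.linearIndependent.linearIndepOn_id).mono
      (t := ((s.image b : Finset E) : Set E)) (by
        rw [Finset.coe_image]; exact Set.image_subset_range _ _)
    exact this

/-- If `A ≤ B` and each pair of eigenvalues `α i`, `β i` lies strictly on one side of `x₀`, then the
space splits into a part where `B` is below `x₀` and a part where `A` is above `x₀`. -/
theorem exists_splitting [FiniteDimensional ℂ E] (hA : ∀ i, A (a i) = (α i : ℂ) • a i)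
    (hB : ∀ i, B (b i) = (β i : ℂ) • b i)
    (hAB : ∀ x, (⟪x, A x⟫_ℂ).re ≤ (⟪x, B x⟫_ℂ).re) {x₀ : ℝ}
    (hx₀ : ∀ i, β i < x₀ ∨ x₀ < α i) :
    ∃ ε > 0, ∃ P : E →L[ℂ] E, ∀ x, (⟪P x, B (P x)⟫_ℂ).re ≤ (x₀ - ε) * ‖P x‖ ^ 2 ∧
      (x₀ + ε) * ‖x - P x‖ ^ 2 ≤ (⟪x - P x, A (x - P x)⟫_ℂ).re := by
  classical
  have hev : ∀ᶠ ε in nhdsWithin (0 : ℝ) (Set.Ioi 0), ∀ i, β i ≤ x₀ - ε ∨ x₀ + ε ≤ α i := by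
    rw [Filter.eventually_all]
    intro i
    rcases hx₀ i with h | h
    · filter_upwards [Ioo_mem_nhdsGT (sub_pos.2 h)] with ε hε
      exact Or.inl (by linarith [hε.2])
    · filter_upwards [Ioo_mem_nhdsGT (sub_pos.2 h)] with ε hε
      exact Or.inr (by linarith [hε.2])
  obtain ⟨ε, hε, hpos⟩ := (hev.and self_mem_nhdsWithin).exists
  have hpos : 0 < ε := hpos
  let s : Finset ι := {i | β i ≤ x₀ - ε}
  have hs : ∀ i ∈ (s : Set ι), β i ≤ x₀ - ε := by simp [s]
  have ht : ∀ i ∈ ((sᶜ : Finset ι) : Set ι), x₀ + ε ≤ α i := by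
    intro i hi
    refine (hε i).resolve_left fun h => ?_
    simp [s] at hi
    linarith
  -- The index sets `s` and `sᶜ` are complementary, so the dimensions of the two disjoint spans add
  -- up to that of the space. The resulting projection need not be orthogonal.
  have hc : IsCompl (Submodule.span ℂ (b '' (s : Set ι)))
      (Submodule.span ℂ (a '' ((sᶜ : Finset ι) : Set ι))) := by
    have hd := disjoint_span_of_lt hA hB hAB (by linarith : x₀ - ε < x₀ + ε) hs ht
    refine ⟨hd, ?_⟩
    rw [codisjoint_iff]
    apply Submodule.eq_top_of_finrank_eq
    have h := Submodule.finrank_sup_add_finrank_inf_eq (Submodule.span ℂ (b '' (s : Set ι)))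
      (Submodule.span ℂ (a '' ((sᶜ : Finset ι) : Set ι)))
    rw [disjoint_iff.1 hd, finrank_bot, finrank_span_image, finrank_span_image, add_zero,
      Finset.card_add_card_compl] at h
    rw [h, Module.finrank_eq_card_basis b.toBasis]
  refine ⟨ε, hpos, LinearMap.toContinuousLinearMap (Submodule.projection _ _ hc), fun x => ⟨?_, ?_⟩⟩
  · exact re_inner_le_of_mem_span b hB hs (Submodule.projection_apply_mem hc x)
  · exact le_re_inner_of_mem_span a hA ht (Submodule.sub_projection_mem hc x)

end FiniteDimensional

/-! ### Eigenvalues of Hermitian matrices. -/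

section Matrix

variable {ι : Type*} [Fintype ι] [DecidableEq ι] {A B : Matrix ι ι ℂ}

theorem toEuclideanLin_eigenvectorBasis (hA : A.IsHermitian) (i : ι) :
    Matrix.toEuclideanLin A (hA.eigenvectorBasis i) =
      (hA.eigenvalues i : ℂ) • hA.eigenvectorBasis i := by
  rw [Matrix.toLpLin_apply, hA.mulVec_eigenvectorBasis]
  rfl

/-- Weyl's monotonicity principle. -/
theorem eigenvalues_le_eigenvalues (hA : A.IsHermitian) (hB : B.IsHermitian)
    (hAB : ∀ x, (⟪x, Matrix.toEuclideanLin A x⟫_ℂ).re ≤ (⟪x, Matrix.toEuclideanLin B x⟫_ℂ).re)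
    (i : ι) : hA.eigenvalues i ≤ hB.eigenvalues i := by
  by_contra! hlt
  let e : Fin (Fintype.card ι) ≃ ι := Fintype.equivOfCardEq (Fintype.card_fin _)
  -- In decreasing order, `s` holds the indices from `i` on and `t` those up to `i`. Both contain
  -- `i`, so the dimensions of the spans sum to more than that of the space, against their
  -- disjointness.
  let s : Finset ι := {j | e.symm i ≤ e.symm j}
  let t : Finset ι := {j | e.symm j ≤ e.symm i}
  have hd := disjoint_span_of_lt (s := (s : Set ι)) (t := (t : Set ι))
    (toEuclideanLin_eigenvectorBasis hA) (toEuclideanLin_eigenvectorBasis hB) hAB hlt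
    (fun j hj => hB.eigenvalues₀_antitone (by simpa [s] using hj))
    (fun j hj => hA.eigenvalues₀_antitone (by simpa [t] using hj))
  have h := Submodule.finrank_sup_add_finrank_inf_eq
    (Submodule.span ℂ (hB.eigenvectorBasis '' (s : Set ι)))
    (Submodule.span ℂ (hA.eigenvectorBasis '' (t : Set ι)))
  rw [disjoint_iff.1 hd, finrank_bot, finrank_span_image, finrank_span_image, add_zero] at h
  have h1 := Submodule.finrank_le (Submodule.span ℂ (hB.eigenvectorBasis '' (s : Set ι)) ⊔
    Submodule.span ℂ (hA.eigenvectorBasis '' (t : Set ι)))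
  rw [h, finrank_euclideanSpace, ← Finset.card_union_add_card_inter] at h1
  have h2 : s ∪ t = Finset.univ := by
    ext j
    simp [s, t, le_total]
  have h3 : 0 < (s ∩ t).card := Finset.card_pos.2 ⟨i, by simp [s, t]⟩
  rw [h2, Finset.card_univ] at h1
  omega

theorem sum_eigenvalues_eq_re_trace (hA : A.IsHermitian) :
    ∑ i, hA.eigenvalues i = A.trace.re := by
  rw [hA.trace_eq_sum_eigenvalues, Complex.re_sum]
  rfl

end Matrix

end DiscreteSchrodinger

/-! ### The quadratic form as a sum over lattice steps. -/

namespace DiscreteSchrodinger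

open scoped InnerProductSpace

/-- The four unit steps to the nearest neighbours of a point of `ℤ²`. -/
def unitSteps : Finset (ℤ × ℤ) := {(0, -1), (0, 1), (-1, 0), (1, 0)}

theorem sum_unitSteps {R : Type*} [AddCommMonoid R] (f : ℤ × ℤ → R) :
    ∑ e ∈ unitSteps, f e = f (0, -1) + f (0, 1) + f (-1, 0) + f (1, 0) := by
  simp [unitSteps, add_assoc]

theorem sum_unitSteps_neg {R : Type*} [AddCommMonoid R] (f : ℤ × ℤ → R) :
    ∑ e ∈ unitSteps, f (-e) = ∑ e ∈ unitSteps, f e := by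
  simp only [sum_unitSteps, Prod.neg_mk, neg_zero, neg_neg]
  abel

theorem schrodinger_apply_eq_sum (q : ℤ → ℤ → ℝ) (hq : IsBoundedSeq q) (u : L2) (p : ℤ × ℤ) :
    schrodinger q hq u p = ∑ e ∈ unitSteps, u (p + e) + (q p.1 p.2 : ℂ) * u p := by
  rw [sum_unitSteps]
  rfl

theorem summable_norm_sq_add (u : L2) (e : ℤ × ℤ) :
    Summable fun p : ℤ × ℤ => ‖u (p + e)‖ ^ 2 :=
  (Equiv.addRight e).summable_iff.2 (summable_sq u)

theorem summable_re_mul_conj (u : L2) (e : ℤ × ℤ) :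
    Summable fun p : ℤ × ℤ => (u (p + e) * (starRingEnd ℂ) (u p)).re := by
  refine Summable.of_norm_bounded ((summable_sq u).add (summable_norm_sq_add u e)) fun p => ?_
  have h1 := Complex.abs_re_le_norm (u (p + e) * (starRingEnd ℂ) (u p))
  rw [norm_mul, RCLike.norm_conj] at h1
  rw [Real.norm_eq_abs]
  nlinarith [sq_nonneg (‖u p‖ - ‖u (p + e)‖), sq_nonneg ‖u p‖, sq_nonneg ‖u (p + e)‖]

theorem summable_potential_mul {q : ℤ → ℤ → ℝ} (hq : IsBoundedSeq q) (u : L2) :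
    Summable fun p : ℤ × ℤ => q p.1 p.2 * ‖u p‖ ^ 2 := by
  obtain ⟨C, hC⟩ := hq
  refine Summable.of_norm_bounded ((summable_sq u).mul_left C) fun p => ?_
  rw [norm_mul, Real.norm_eq_abs, Real.norm_of_nonneg (sq_nonneg _)]
  gcongr
  exact hC _ _

theorem summable_ite {f : ℤ × ℤ → ℝ} (hf : Summable f) (χ : ℤ × ℤ → Prop) [DecidablePred χ] :
    Summable fun p => if χ p then f p else 0 := by
  refine Summable.of_norm_bounded hf.norm fun p => ?_
  split_ifs
  · exact le_rfl
  · simp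

theorem re_inner_schrodinger {q : ℤ → ℤ → ℝ} (hq : IsBoundedSeq q) (u : L2) :
    (⟪u, schrodinger q hq u⟫_ℂ).re =
      ∑' p : ℤ × ℤ, (∑ e ∈ unitSteps, (u (p + e) * (starRingEnd ℂ) (u p)).re + q p.1 p.2 * ‖u p‖ ^ 2) := by
  rw [lp.inner_eq_tsum, Complex.re_tsum (lp.summable_inner _ _)]
  refine tsum_congr fun p => ?_
  rw [schrodinger_apply_eq_sum, RCLike.inner_apply, add_mul, Finset.sum_mul, Complex.add_re,
    Complex.re_sum]
  congr 1
  rw [mul_assoc, Complex.mul_conj, Complex.normSq_eq_norm_sq,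
    ← Complex.ofReal_mul, Complex.ofReal_re]

/-! ### Cells, decoupling and the upper bound for the measure. -/

section Cells

variable (N M : ℕ) [NeZero N] [NeZero M]

/-- The decomposition of `ℤ²` into cells of size `N × M`: a point is given by the index of its cell
and by its position in the cell. -/
def cellEquiv : ℤ × ℤ ≃ (ℤ × ℤ) × (Fin N × Fin M) :=
  ((Int.divModEquiv N).prodCongr (Int.divModEquiv M)).trans (Equiv.prodProdProdComm _ _ _ _)

theorem cellEquiv_symm_apply (c : ℤ × ℤ) (i : Fin N × Fin M) :
    (cellEquiv N M).symm (c, i) = (c.1 * N + (i.1 : ℕ), c.2 * M + (i.2 : ℕ)) := rfl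

theorem cellEquiv_fst (p : ℤ × ℤ) : (cellEquiv N M p).1 = (p.1 / N, p.2 / M) := rfl

theorem cellEquiv_symm_eq_add (c : ℤ × ℤ) (i : Fin N × Fin M) :
    (cellEquiv N M).symm (c, i) = (c.1 * N, c.2 * M) + (cellEquiv N M).symm (0, i) := by
  simp [cellEquiv_symm_apply]

theorem cellEquiv_translate (c p : ℤ × ℤ) :
    cellEquiv N M ((c.1 * N, c.2 * M) + p) = (c + (cellEquiv N M p).1, (cellEquiv N M p).2) := by
  rw [← Equiv.eq_symm_apply, cellEquiv_symm_eq_add]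
  have h := cellEquiv_symm_eq_add N M (cellEquiv N M p).1 (cellEquiv N M p).2
  rw [Prod.mk.eta, Equiv.symm_apply_apply] at h
  conv_lhs => rw [h]
  ext <;> simp <;> ring

theorem cellEquiv_symm_add (c e : ℤ × ℤ) (i : Fin N × Fin M) :
    cellEquiv N M ((cellEquiv N M).symm (c, i) + e) =
      (c + (cellEquiv N M ((cellEquiv N M).symm (0, i) + e)).1,
        (cellEquiv N M ((cellEquiv N M).symm (0, i) + e)).2) := by
  rw [cellEquiv_symm_eq_add, add_assoc, cellEquiv_translate]

variable {N M} in
theorem IsPeriodic.apply_cellEquiv_symm {q : ℤ → ℤ → ℝ} (hq : IsPeriodic N M q) (c : ℤ × ℤ)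
    (i : Fin N × Fin M) :
    q ((cellEquiv N M).symm (c, i)).1 ((cellEquiv N M).symm (c, i)).2 =
      q ((cellEquiv N M).symm (0, i)).1 ((cellEquiv N M).symm (0, i)).2 := by
  have h1 : ∀ m : ℤ, Function.Periodic (fun n => q n m) (N : ℤ) := fun m n => hq.1 n m
  have h2 : ∀ n : ℤ, Function.Periodic (fun m => q n m) (M : ℤ) := fun n m => hq.2 n m
  have h1' := (h1 (c.2 * M + (i.2 : ℕ))).int_mul c.1 ((i.1 : ℕ) : ℤ)
  have h2' := (h2 ((i.1 : ℕ) : ℤ)).int_mul c.2 ((i.2 : ℕ) : ℤ)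
  simp only [Int.cast_id] at h1' h2'
  simp only [cellEquiv_symm_apply, Prod.fst_zero, Prod.snd_zero, zero_mul, zero_add]
  rw [add_comm (c.1 * (N : ℤ)), h1', add_comm (c.2 * (M : ℤ)), h2']

/-- The step `e` from `p` leads to another cell. -/
def IsCrossing (e p : ℤ × ℤ) : Prop := (cellEquiv N M (p + e)).1 ≠ (cellEquiv N M p).1

noncomputable instance (e : ℤ × ℤ) : DecidablePred (IsCrossing N M e) := Classical.decPred _

theorem isCrossing_neg_add (e p : ℤ × ℤ) : IsCrossing N M (-e) (p + e) ↔ IsCrossing N M e p := by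
  rw [IsCrossing, IsCrossing, add_neg_cancel_right, ne_comm]

/-- Reversing a step, `(e, p) ↦ (-e, p + e)`, permutes the crossing steps and changes the sign of
the summand. -/
theorem hasSum_crossing (u : L2) :
    HasSum (fun p : ℤ × ℤ => ∑ e ∈ unitSteps, if IsCrossing N M e p then
      (‖u p‖ ^ 2 - ‖u (p + e)‖ ^ 2) / 2 else 0) 0 := by
  let F : ℤ × ℤ → ℤ × ℤ → ℝ := fun e p => if IsCrossing N M e p then ‖u p‖ ^ 2 else 0
  have hF : ∀ e, HasSum (F e) (∑' p, F e p) := fun e => (summable_ite (summable_sq u) _).hasSum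
  have hF' : ∀ e, HasSum (fun p => F (-e) (p + e)) (∑' p, F (-e) p) := fun e =>
    (Equiv.addRight e).hasSum_iff.2 (hF (-e))
  have h := hasSum_sum (s := unitSteps) fun e _ => ((hF e).sub (hF' e)).div_const 2
  have h0 : ∑ e ∈ unitSteps, (∑' p, F e p - ∑' p, F (-e) p) / 2 = 0 := by
    rw [← Finset.sum_div, Finset.sum_sub_distrib, sum_unitSteps_neg (fun e => ∑' p, F e p), sub_self,
      zero_div]
  rw [h0] at h
  refine h.congr_fun fun p => Finset.sum_congr rfl fun e _ => ?_
  simp only [F, isCrossing_neg_add]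
  split_ifs <;> simp

variable (q : ℤ → ℤ → ℝ) (σ : ℝ)

/-- The density of the energy, where the interaction between neighbours in distinct cells is
replaced by the on-site term `σ`. -/
noncomputable def energyDensity (u : L2) (p : ℤ × ℤ) : ℝ :=
  ∑ e ∈ unitSteps, (if IsCrossing N M e p then σ * ‖u p‖ ^ 2 else (u (p + e) * (starRingEnd ℂ) (u p)).re) +
    q p.1 p.2 * ‖u p‖ ^ 2

variable {q} in
theorem summable_energyDensity (hq : IsBoundedSeq q) (u : L2) :
    Summable (energyDensity N M q σ u) := by
  refine (summable_sum fun e _ => ?_).add (summable_potential_mul hq u)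
  have h := (summable_ite ((summable_sq u).mul_left σ) (fun p => IsCrossing N M e p)).add
    (summable_ite (summable_re_mul_conj u e) (fun p => ¬ IsCrossing N M e p))
  refine h.congr fun p => ?_
  split_ifs <;> simp

/-- This is `‖x‖‖y‖ ≤ (‖x‖² + ‖y‖²) / 2`, written as an on-site term minus an antisymmetric one,
which `hasSum_crossing` removes after summation. -/
theorem re_mul_conj_le (x y : ℂ) :
    (y * (starRingEnd ℂ) x).re ≤ ‖x‖ ^ 2 - (‖x‖ ^ 2 - ‖y‖ ^ 2) / 2 := by
  have h1 := Complex.re_le_norm (y * (starRingEnd ℂ) x)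
  rw [norm_mul, RCLike.norm_conj] at h1
  nlinarith [sq_nonneg (‖x‖ - ‖y‖)]

theorem le_re_mul_conj (x y : ℂ) :
    -‖x‖ ^ 2 + (‖x‖ ^ 2 - ‖y‖ ^ 2) / 2 ≤ (y * (starRingEnd ℂ) x).re := by
  have h1 := re_mul_conj_le (-x) y
  rw [map_neg, mul_neg, Complex.neg_re, norm_neg] at h1
  linarith

variable {q}

theorem re_inner_schrodinger_le (hq : IsBoundedSeq q) (u : L2) :
    (⟪u, schrodinger q hq u⟫_ℂ).re ≤ ∑' p, energyDensity N M q 1 u p := by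
  have h0 := hasSum_crossing N M u
  have hg := summable_energyDensity N M 1 hq u
  rw [re_inner_schrodinger, ← sub_zero (∑' p, energyDensity N M q 1 u p), ← h0.tsum_eq,
    ← hg.tsum_sub h0.summable]
  refine Summable.tsum_le_tsum (fun p => ?_) ?_ (hg.sub h0.summable)
  · rw [energyDensity, add_sub_right_comm, ← Finset.sum_sub_distrib]
    gcongr with e he
    split_ifs
    · rw [one_mul]
      exact re_mul_conj_le _ _
    · rw [sub_zero]
  · exact (summable_sum fun e _ => summable_re_mul_conj u e).add (summable_potential_mul hq u)

theorem le_re_inner_schrodinger (hq : IsBoundedSeq q) (u : L2) :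
    ∑' p, energyDensity N M q (-1) u p ≤ (⟪u, schrodinger q hq u⟫_ℂ).re := by
  have h0 := hasSum_crossing N M u
  have hg := summable_energyDensity N M (-1) hq u
  rw [re_inner_schrodinger, ← add_zero (∑' p, energyDensity N M q (-1) u p), ← h0.tsum_eq,
    ← hg.tsum_add h0.summable]
  refine Summable.tsum_le_tsum (fun p => ?_) (hg.add h0.summable) ?_
  · rw [energyDensity, add_right_comm, ← Finset.sum_add_distrib]
    gcongr with e he
    split_ifs
    · rw [neg_one_mul]
      exact le_re_mul_conj _ _
    · rw [add_zero]
  · exact (summable_sum fun e _ => summable_re_mul_conj u e).add (summable_potential_mul hq u)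

variable (q)

/-- The number of steps from the position `i` that leave the cell. -/
noncomputable def crossingNumber (i : Fin N × Fin M) : ℕ :=
  ∑ e ∈ unitSteps, if IsCrossing N M e ((cellEquiv N M).symm (0, i)) then 1 else 0

/-- The operator restricted to one cell, with the on-site term `σ` for each neighbour outside. -/
noncomputable def cellMatrix : Matrix (Fin N × Fin M) (Fin N × Fin M) ℂ := fun i j =>
  ∑ e ∈ unitSteps, (if (cellEquiv N M).symm (0, i) + e = (cellEquiv N M).symm (0, j) then 1 else 0) +
    Matrix.diagonal (fun i => ((q ((cellEquiv N M).symm (0, i)).1 ((cellEquiv N M).symm (0, i)).2 +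
      σ * crossingNumber N M i : ℝ) : ℂ)) i j

theorem cellMatrix_isHermitian : (cellMatrix N M q σ).IsHermitian := by
  have hd : (Matrix.diagonal (fun i => ((q ((cellEquiv N M).symm (0, i)).1
      ((cellEquiv N M).symm (0, i)).2 + σ * crossingNumber N M i : ℝ) : ℂ))).IsHermitian := by
    refine Matrix.isHermitian_diagonal_of_self_adjoint _ ?_
    ext i
    exact Complex.conj_ofReal _
  refine Matrix.IsHermitian.ext fun i j => ?_
  rw [cellMatrix, cellMatrix, star_add, hd.apply]
  congr 1
  rw [star_sum, ← sum_unitSteps_neg]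
  refine Finset.sum_congr rfl fun e _ => ?_
  rw [apply_ite star, star_one, star_zero]
  refine if_congr ?_ rfl rfl
  rw [← sub_eq_add_neg, sub_eq_iff_eq_add, eq_comm]

variable {N M} in
/-- The restriction of `u` to the cell with index `c`. -/
def cellRestrict (u : L2) (c : ℤ × ℤ) : EuclideanSpace ℂ (Fin N × Fin M) :=
  WithLp.toLp 2 fun i => u ((cellEquiv N M).symm (c, i))

theorem cellRestrict_apply (u : L2) (c : ℤ × ℤ) (i : Fin N × Fin M) :
    cellRestrict u c i = u ((cellEquiv N M).symm (c, i)) := rfl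

variable {N M q}

theorem toEuclideanLin_cellMatrix_apply (u : L2) (c : ℤ × ℤ) (i : Fin N × Fin M) :
    Matrix.toEuclideanLin (cellMatrix N M q σ) (cellRestrict u c) i =
      ∑ e ∈ unitSteps, (if IsCrossing N M e ((cellEquiv N M).symm (c, i)) then 0 else
        u ((cellEquiv N M).symm (c, i) + e)) +
      ((q ((cellEquiv N M).symm (0, i)).1 ((cellEquiv N M).symm (0, i)).2 +
        σ * crossingNumber N M i : ℝ) : ℂ) * u ((cellEquiv N M).symm (c, i)) := by
  rw [Matrix.toLpLin_apply]
  change ∑ j, cellMatrix N M q σ i j * u ((cellEquiv N M).symm (c, j)) = _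
  simp only [cellMatrix, add_mul, Finset.sum_add_distrib]
  congr 1
  · simp only [Finset.sum_mul]
    rw [Finset.sum_comm]
    refine Finset.sum_congr rfl fun e _ => ?_
    have h := cellEquiv_symm_add N M c e i
    simp only [ite_mul, one_mul, zero_mul, Equiv.eq_symm_apply, IsCrossing, h,
      Equiv.apply_symm_apply]
    generalize cellEquiv N M ((cellEquiv N M).symm (0, i) + e) = z at h
    obtain ⟨d, k⟩ := z
    -- If the step stays in the cell, exactly one column `j` contributes; otherwise none does.
    by_cases hd : d = 0
    · subst hd
      rw [add_zero, ← Equiv.eq_symm_apply] at h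
      simp [h]
    · simp [hd]
  · simp [Matrix.diagonal_apply]

/-- Periodicity of `q` lets the matrix of the cell `0` serve every cell `c`. -/
theorem re_inner_cellMatrix (hq : IsPeriodic N M q) (u : L2) (c : ℤ × ℤ) :
    (⟪cellRestrict u c, Matrix.toEuclideanLin (cellMatrix N M q σ) (cellRestrict u c)⟫_ℂ).re =
      ∑ i, energyDensity N M q σ u ((cellEquiv N M).symm (c, i)) := by
  rw [PiLp.inner_apply, Complex.re_sum]
  refine Finset.sum_congr rfl fun i _ => ?_
  rw [toEuclideanLin_cellMatrix_apply, cellRestrict_apply, energyDensity,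
    hq.apply_cellEquiv_symm c i, RCLike.inner_apply, add_mul, Finset.sum_mul, Complex.add_re,
    Complex.re_sum, mul_assoc, Complex.mul_conj, Complex.normSq_eq_norm_sq, ← Complex.ofReal_mul,
    Complex.ofReal_re, add_comm (q _ _), add_mul, ← add_assoc]
  congr 1
  rw [crossingNumber, Nat.cast_sum, Finset.mul_sum, Finset.sum_mul, ← Finset.sum_add_distrib]
  refine Finset.sum_congr rfl fun e _ => ?_
  have h := cellEquiv_symm_add N M c e i
  have hcr : IsCrossing N M e ((cellEquiv N M).symm (c, i)) ↔
      IsCrossing N M e ((cellEquiv N M).symm (0, i)) := by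
    simp only [IsCrossing, h, Equiv.apply_symm_apply, ne_eq, add_eq_left]
  simp only [hcr]
  split_ifs <;> simp

theorem hasSum_cells {f : ℤ × ℤ → ℝ} (hf : Summable f) :
    HasSum (fun c => ∑ i, f ((cellEquiv N M).symm (c, i))) (∑' p, f p) := by
  have h := (cellEquiv N M).symm.hasSum_iff.2 hf.hasSum
  exact h.prod_fiberwise fun c => hasSum_fintype _

theorem norm_sq_cellRestrict (u : L2) (c : ℤ × ℤ) :
    ‖(cellRestrict u c : EuclideanSpace ℂ (Fin N × Fin M))‖ ^ 2 =
      ∑ i, ‖u ((cellEquiv N M).symm (c, i))‖ ^ 2 := by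
  rw [EuclideanSpace.norm_sq_eq]
  rfl

theorem hasSum_norm_sq_cellRestrict (u : L2) :
    HasSum (fun c => ‖(cellRestrict u c : EuclideanSpace ℂ (Fin N × Fin M))‖ ^ 2) (‖u‖ ^ 2) := by
  simp only [norm_sq_cellRestrict]
  rw [norm_sq_eq]
  exact hasSum_cells (f := fun p => ‖u p‖ ^ 2) (summable_sq u)

/-- A linear map on the functions on one cell acts on `ℓ²(ℤ²)` cell by cell. -/
theorem exists_cellRestrict_eq
    (P : EuclideanSpace ℂ (Fin N × Fin M) →L[ℂ] EuclideanSpace ℂ (Fin N × Fin M)) (u : L2) :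
    ∃ v : L2, ∀ c, cellRestrict v c = P (cellRestrict u c) := by
  let f : ℤ × ℤ → ℂ := fun p => P (cellRestrict u (cellEquiv N M p).1) (cellEquiv N M p).2
  have hf : Summable fun p => ‖f p‖ ^ 2 := by
    rw [← (cellEquiv N M).symm.summable_iff,
      summable_prod_of_nonneg (fun _ => by dsimp only [Function.comp_apply]; positivity)]
    refine ⟨fun c => (hasSum_fintype _).summable, ?_⟩
    have hs := (hasSum_norm_sq_cellRestrict (N := N) (M := M) u).summable.mul_left (‖P‖ ^ 2)
    refine Summable.of_nonneg_of_le (fun c => tsum_nonneg fun i => sq_nonneg _) (fun c => ?_) hs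
    simp only [tsum_fintype, Function.comp_apply, f, Equiv.apply_symm_apply]
    rw [← EuclideanSpace.norm_sq_eq, ← mul_pow]
    gcongr
    exact P.le_opNorm _
  refine ⟨⟨f, memℓp_two hf⟩, fun c => ?_⟩
  ext i
  change P (cellRestrict u (cellEquiv N M ((cellEquiv N M).symm (c, i))).1)
    (cellEquiv N M ((cellEquiv N M).symm (c, i))).2 = _
  rw [Equiv.apply_symm_apply]

variable (N M) in
-- Steps in the second coordinate leave from its first and last values, giving `2N` in all; those in
-- the first coordinate give `2M`. For a side of length one, `0` and `Fin.rev 0` coincide and the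
-- position rightly counts twice.
theorem sum_crossingNumber : ∑ i, crossingNumber N M i = 2 * (N + M) := by
  have hdiv : ∀ (K : ℕ) [NeZero K] (e : ℤ) (k : Fin K), |e| = 1 →
      ((((k : ℕ) : ℤ) + e) / (K : ℤ) ≠ 0 ↔ k = if e = 1 then Fin.rev 0 else 0) := by
    intro K _ e k he
    have hK : (0 : ℤ) < K := by exact_mod_cast Nat.pos_of_neZero K
    have hk := k.isLt
    have h0 : ((0 : Fin K) : ℕ) = 0 := Nat.zero_mod K
    rw [ne_eq, Fin.ext_iff]
    rcases (abs_eq zero_le_one).1 he with rfl | rfl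
    · rcases (show (k : ℕ) + 1 ≤ K from hk).eq_or_lt with h | h
      · have h' : ((k : ℕ) : ℤ) + 1 = K := by exact_mod_cast h
        rw [h', Int.ediv_self hK.ne']
        simp only [one_ne_zero, not_false_eq_true, if_true, Fin.val_rev, h0, true_iff]
        omega
      · rw [Int.ediv_eq_zero_of_lt (by positivity) (by exact_mod_cast h)]
        simp only [not_true_eq_false, if_true, Fin.val_rev, h0, false_iff]
        omega
    · rcases Nat.eq_zero_or_pos (k : ℕ) with h | h
      · rw [h]
        simp [(Int.ediv_neg_of_neg_of_pos (show (-1 : ℤ) < 0 by norm_num) hK).ne]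
      · rw [Int.ediv_eq_zero_of_lt (by omega) (by omega)]
        simp
        omega
  have hz : ∀ (K : ℕ) [NeZero K] (k : Fin K), (((k : ℕ) : ℤ)) / (K : ℤ) = 0 := fun K _ k =>
    Int.ediv_eq_zero_of_lt (by positivity) (by exact_mod_cast k.isLt)
  have h1 : ∀ i : Fin N × Fin M, crossingNumber N M i =
      ((if i.2 = 0 then 1 else 0) + (if i.2 = Fin.rev 0 then 1 else 0)) +
      ((if i.1 = 0 then 1 else 0) + (if i.1 = Fin.rev 0 then 1 else 0)) := by
    intro i
    have a1 := hdiv N (-1) i.1 rfl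
    have a2 := hdiv N 1 i.1 rfl
    have b1 := hdiv M (-1) i.2 rfl
    have b2 := hdiv M 1 i.2 rfl
    norm_num at a1 a2 b1 b2
    rw [crossingNumber, sum_unitSteps]
    simp only [IsCrossing, Equiv.apply_symm_apply]
    simp [cellEquiv_fst, cellEquiv_symm_apply, Prod.ext_iff, hz, a1, a2, b1, b2, add_assoc,
      -Int.reduceNeg]
  have h2 : ∀ (K : ℕ) [NeZero K],
      ∑ k : Fin K, ((if k = 0 then 1 else 0) + (if k = Fin.rev 0 then 1 else 0)) = 2 := by
    intro K _
    simp [Finset.sum_add_distrib]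
  rw [Finset.sum_congr rfl fun i _ => h1 i, Finset.sum_add_distrib, Fintype.sum_prod_type,
    Fintype.sum_prod_type_right]
  simp only [Finset.sum_const, h2, Finset.card_univ, Fintype.card_fin, smul_eq_mul]
  ring

theorem trace_cellMatrix_sub (q : ℤ → ℤ → ℝ) :
    (cellMatrix N M q 1).trace.re - (cellMatrix N M q (-1)).trace.re = 4 * (N + M) := by
  have h : (∑ i, (crossingNumber N M i : ℝ)) = 2 * (N + M) := by
    exact_mod_cast congrArg (Nat.cast (R := ℝ)) (sum_crossingNumber N M)
  simp only [Matrix.trace, Matrix.diag, cellMatrix, Matrix.diagonal_apply_eq, Complex.re_sum,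
    Complex.add_re, Complex.ofReal_re]
  rw [← Finset.sum_sub_distrib]
  have h2 : (4 * (N + M) : ℝ) = ∑ i, 2 * (crossingNumber N M i : ℝ) := by
    rw [← Finset.mul_sum, h]
    ring
  rw [h2]
  refine Finset.sum_congr rfl fun i _ => ?_
  ring

theorem re_inner_cellMatrix_mono (x : EuclideanSpace ℂ (Fin N × Fin M)) :
    (⟪x, Matrix.toEuclideanLin (cellMatrix N M q (-1)) x⟫_ℂ).re ≤
      (⟪x, Matrix.toEuclideanLin (cellMatrix N M q 1) x⟫_ℂ).re := by
  have h : cellMatrix N M q 1 = cellMatrix N M q (-1) +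
      Matrix.diagonal fun i => ((2 * crossingNumber N M i : ℝ) : ℂ) := by
    ext i j
    simp only [cellMatrix, Matrix.add_apply, Matrix.diagonal_apply]
    split_ifs
    · push_cast
      ring
    · simp
  rw [h, map_add, LinearMap.add_apply, inner_add_right, Complex.add_re, le_add_iff_nonneg_right,
    PiLp.inner_apply, Complex.re_sum]
  refine Finset.sum_nonneg fun i _ => ?_
  rw [Matrix.toLpLin_apply, RCLike.inner_apply, WithLp.ofLp_toLp, Matrix.mulVec_diagonal, mul_assoc,
    Complex.mul_conj, ← Complex.ofReal_mul, Complex.ofReal_re]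
  have := Complex.normSq_nonneg (x i)
  positivity

/-- The spectrum is contained in the union of the intervals between the eigenvalues of the two
matrices on a cell. -/
theorem realSpectrum_subset (hq : IsPeriodic N M q) (hb : IsBoundedSeq q) :
    realSpectrum (schrodinger q hb) ⊆ ⋃ i, Set.Icc
      ((cellMatrix_isHermitian N M q (-1)).eigenvalues i)
      ((cellMatrix_isHermitian N M q 1).eigenvalues i) := by
  intro x hx
  by_contra hout
  have hgap : ∀ i, (cellMatrix_isHermitian N M q 1).eigenvalues i < x ∨
      x < (cellMatrix_isHermitian N M q (-1)).eigenvalues i := by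
    intro i
    by_contra! hi
    exact hout (Set.mem_iUnion.2 ⟨i, hi.2, hi.1⟩)
  obtain ⟨ε, hε, P, hP⟩ := exists_splitting
    (toEuclideanLin_eigenvectorBasis (cellMatrix_isHermitian N M q (-1)))
    (toEuclideanLin_eigenvectorBasis (cellMatrix_isHermitian N M q 1))
    re_inner_cellMatrix_mono hgap
  refine hx ?_
  rw [spectrum.mem_resolventSet_iff, IsUnit.sub_iff]
  have hsa : IsSelfAdjoint (schrodinger q hb - algebraMap ℂ (L2 →L[ℂ] L2) (x : ℂ)) :=
    (schrodinger_isSelfAdjoint q hb).sub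
      ((show IsSelfAdjoint (x : ℂ) from Complex.conj_ofReal x).algebraMap _)
  refine isUnit_of_forall_exists_add hsa hε fun u => ?_
  have hre : ∀ v : L2, (⟪v, (schrodinger q hb - algebraMap ℂ (L2 →L[ℂ] L2) (x : ℂ)) v⟫_ℂ).re =
      (⟪v, schrodinger q hb v⟫_ℂ).re - x * ‖v‖ ^ 2 := by
    intro v
    rw [sub_apply, inner_sub_right, Complex.sub_re, Algebra.algebraMap_eq_smul_one]
    change _ - (⟪v, (x : ℂ) • v⟫_ℂ).re = _
    rw [inner_smul_right, inner_self_eq_norm_sq_to_K, ← Complex.coe_algebraMap, ← map_pow, Complex.coe_algebraMap,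
      ← Complex.ofReal_mul, Complex.ofReal_re]
  obtain ⟨v, hv⟩ := exists_cellRestrict_eq P u
  -- Here `v` is the cellwise projection of `u`: the upper form controls `v`, the lower form
  -- controls `u - v`.
  refine ⟨v, u - v, (add_sub_cancel _ _).symm, ?_, ?_⟩
  · have h1 := hasSum_cells (N := N) (M := M) (summable_energyDensity N M 1 hb v)
    have h2 := (hasSum_norm_sq_cellRestrict (N := N) (M := M) v).mul_left (x - ε)
    have h3 := hasSum_le (fun c => by
      rw [← re_inner_cellMatrix 1 hq, hv]
      exact (hP _).1) h1 h2
    have h4 := re_inner_schrodinger_le N M hb v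
    rw [hre]
    linarith
  · have h1 := hasSum_cells (N := N) (M := M) (summable_energyDensity N M (-1) hb (u - v))
    have h2 := (hasSum_norm_sq_cellRestrict (N := N) (M := M) (u - v)).mul_left (x + ε)
    have h3 := hasSum_le (fun c => by
      have hsub : (cellRestrict (u - v) c : EuclideanSpace ℂ (Fin N × Fin M)) =
          cellRestrict u c - P (cellRestrict u c) := by
        rw [← hv]
        rfl
      rw [← re_inner_cellMatrix (-1) hq, hsub]
      exact (hP _).2) h2 h1
    have h4 := le_re_inner_schrodinger N M hb (u - v)
    rw [hre]
    linarith

/-- Weyl monotonicity makes all interval lengths nonnegative, so they sum to a difference of traces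
and no individual eigenvalue is needed. -/
theorem volume_realSpectrum_le (hq : IsPeriodic N M q) (hb : IsBoundedSeq q) :
    MeasureTheory.volume (realSpectrum (schrodinger q hb)) ≤ 4 * ((N : ℝ≥0∞) + M) := by
  have hle := eigenvalues_le_eigenvalues (cellMatrix_isHermitian N M q (-1))
    (cellMatrix_isHermitian N M q 1) re_inner_cellMatrix_mono
  calc MeasureTheory.volume (realSpectrum (schrodinger q hb))
      ≤ ∑ i, MeasureTheory.volume (Set.Icc ((cellMatrix_isHermitian N M q (-1)).eigenvalues i)
          ((cellMatrix_isHermitian N M q 1).eigenvalues i)) :=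
        (MeasureTheory.measure_mono (realSpectrum_subset hq hb)).trans
          (MeasureTheory.measure_iUnion_fintype_le _ _)
    _ = ENNReal.ofReal (4 * (N + M)) := by
        simp only [Real.volume_Icc]
        rw [← ENNReal.ofReal_sum_of_nonneg (fun i _ => sub_nonneg.2 (hle i)),
          Finset.sum_sub_distrib, sum_eigenvalues_eq_re_trace, sum_eigenvalues_eq_re_trace,
          trace_cellMatrix_sub]
    _ = 4 * ((N : ℝ≥0∞) + M) := by
        rw [ENNReal.ofReal_mul (by norm_num), ENNReal.ofReal_add (by positivity) (by positivity)]
        simp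

end Cells

end DiscreteSchrodinger

/-! ### Approximate eigenvectors for a constant potential. -/

namespace DiscreteSchrodinger

theorem exists_pos_le_of_isUnit {T : L2 →L[ℂ] L2} (hT : IsUnit T) :
    ∃ c > 0, ∀ u, c * ‖u‖ ≤ ‖T u‖ := by
  obtain ⟨T, rfl⟩ := hT
  let R : L2 →L[ℂ] L2 := ↑T⁻¹
  refine ⟨(‖R‖ + 1)⁻¹, by positivity, fun u => ?_⟩
  have h : R (T.val u) = u := by
    have := T.inv_mul
    exact congrArg (fun S : L2 →L[ℂ] L2 => S u) this
  rw [inv_mul_le_iff₀ (by positivity)]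
  calc ‖u‖ = ‖R (T.val u)‖ := by rw [h]
    _ ≤ ‖R‖ * ‖T.val u‖ := R.le_opNorm _
    _ ≤ (‖R‖ + 1) * ‖T.val u‖ := by gcongr; linarith

theorem summable_pow_natAbs {r : ℝ} (h0 : 0 ≤ r) (h1 : r < 1) :
    Summable fun n : ℤ => r ^ n.natAbs := by
  refine Summable.of_nat_of_neg ?_ ?_ <;>
    simpa using summable_geometric_of_lt_one h0 h1

/-- An exponentially decaying modification of a plane wave. -/
theorem exists_dampedWave {r : ℝ} (h0 : 0 < r) (h1 : r < 1) (θ : ℝ) :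
    ∃ u : L2, ∀ p : ℤ × ℤ, u p = (r ^ (p.1.natAbs + p.2.natAbs) : ℝ) *
      Complex.exp (θ * Complex.I * (p.1 + p.2)) := by
  refine ⟨⟨_, memℓp_two (f := fun p : ℤ × ℤ => ((r ^ (p.1.natAbs + p.2.natAbs) : ℝ) : ℂ) *
      Complex.exp (θ * Complex.I * (p.1 + p.2))) ?_⟩, fun p => rfl⟩
  have hs := summable_pow_natAbs (sq_nonneg r) (by nlinarith : r ^ 2 < 1)
  have h := hs.mul_of_nonneg hs (fun _ => by positivity) (fun _ => by positivity)
  refine h.congr fun p => ?_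
  have h2 : ((θ : ℂ) * Complex.I * (p.1 + p.2)) = ((θ * (p.1 + p.2) : ℝ) : ℂ) * Complex.I := by
    push_cast
    ring
  rw [norm_mul, h2, Complex.norm_exp_ofReal_mul_I, Complex.norm_real,
    Real.norm_of_nonneg (by positivity), mul_one, ← pow_add]
  ring

/-- The extreme case is `k = j + 1`, where equality holds; for `j = k + 1` one uses `1 - r ≤ r⁻¹ -
1`. -/
theorem abs_pow_sub_pow_le {r : ℝ} (h0 : 0 < r) (h1 : r < 1) {j k : ℕ} (hjk : j ≤ k + 1)
    (hkj : k ≤ j + 1) : |r ^ j - r ^ k| ≤ (r⁻¹ - 1) * r ^ k := by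
  have hr : 1 ≤ r⁻¹ := (one_le_inv₀ h0).2 h1.le
  have hk : 0 < r ^ k := by positivity
  rcases lt_trichotomy j k with h | h | h
  · obtain rfl : k = j + 1 := by omega
    have h3 : 0 < r ^ j := by positivity
    rw [pow_succ, abs_of_nonneg (by nlinarith)]
    refine le_of_eq ?_
    field_simp
  · subst h
    rw [sub_self, abs_zero]
    nlinarith
  · obtain rfl : j = k + 1 := by omega
    rw [abs_sub_comm, pow_succ, abs_of_nonneg (by nlinarith)]
    have h2 : 1 - r ≤ r⁻¹ - 1 := by
      have : r * r⁻¹ = 1 := mul_inv_cancel₀ h0.ne'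
      nlinarith [sq_nonneg (r - 1), inv_pos.2 h0]
    nlinarith

theorem Icc_subset_realSpectrum {q : ℤ → ℤ → ℝ} (hq : IsBoundedSeq q) {c : ℝ}
    (hc : ∀ n m, q n m = c) : Set.Icc (c - 4) (c + 4) ⊆ realSpectrum (schrodinger q hq) := by
  intro x hx hunit
  rw [spectrum.mem_resolventSet_iff, IsUnit.sub_iff] at hunit
  obtain ⟨ε, hε, hbound⟩ := exists_pos_le_of_isUnit hunit
  -- The wave `exp (iθ(n+m))` formally has eigenvalue `c + 4 cos θ`, so `θ` is chosen to make this
  -- `x`.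
  set θ : ℝ := Real.arccos ((x - c) / 4)
  have hcos : Real.cos θ = (x - c) / 4 :=
    Real.cos_arccos (by linarith [hx.1]) (by linarith [hx.2])
  obtain ⟨r, h0, h1, hr⟩ : ∃ r : ℝ, 0 < r ∧ r < 1 ∧ 4 * (r⁻¹ - 1) < ε := by
    -- This value gives `4 (r⁻¹ - 1) = ε / 2`.
    refine ⟨(1 + ε / 8)⁻¹, by positivity, inv_lt_one_of_one_lt₀ (by linarith), ?_⟩
    rw [inv_inv]
    linarith
  obtain ⟨u, hu⟩ := exists_dampedWave h0 h1 θ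
  set w : ℤ → ℤ → ℝ := fun n m => r ^ (n.natAbs + m.natAbs) with hw
  set T := schrodinger q hq - algebraMap ℂ (L2 →L[ℂ] L2) (x : ℂ)
  have hexp : Complex.exp (θ * Complex.I) + Complex.exp (-(θ * Complex.I)) = (x - c) / 2 := by
    have h2 := Complex.two_cos (θ : ℂ)
    rw [← Complex.ofReal_cos, hcos] at h2
    rw [← neg_mul, ← h2]
    push_cast
    ring
  have hnorm : ∀ t : ℤ, ‖Complex.exp (θ * Complex.I * t)‖ = 1 := fun t => by
    have h2 : (θ : ℂ) * Complex.I * t = ((θ * t : ℝ) : ℂ) * Complex.I := by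
      push_cast
      ring
    rw [h2, Complex.norm_exp_ofReal_mul_I]
  have hu' : ∀ n m : ℤ, u (n, m) = (w n m : ℂ) * Complex.exp (θ * Complex.I * (n + m)) :=
    fun n m => hu (n, m)
  -- The undamped wave is annihilated, so only differences of neighbouring weights remain, four in
  -- number.
  have hpt : ∀ n m : ℤ, T u (n, m) = Complex.exp (θ * Complex.I * (n + m)) *
      ((((w n (m - 1) - w n m : ℝ) : ℂ) + ((w (n - 1) m - w n m : ℝ) : ℂ)) *
          Complex.exp (-(θ * Complex.I)) +
        (((w n (m + 1) - w n m : ℝ) : ℂ) + ((w (n + 1) m - w n m : ℝ) : ℂ)) *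
          Complex.exp (θ * Complex.I)) := by
    intro n m
    have h3 : T u (n, m) = schrodinger q hq u (n, m) - x * u (n, m) := rfl
    have h4 : ∀ z : ℂ, Complex.exp (θ * Complex.I * (z + 1)) =
        Complex.exp (θ * Complex.I * z) * Complex.exp (θ * Complex.I) := fun z => by
      rw [← Complex.exp_add]
      congr 1
      ring
    have h5 : ∀ z : ℂ, Complex.exp (θ * Complex.I * (z - 1)) =
        Complex.exp (θ * Complex.I * z) * Complex.exp (-(θ * Complex.I)) := fun z => by
      rw [← Complex.exp_add]
      congr 1
      ring
    have h6 := h4 (n + m)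
    have h7 := h5 (n + m)
    rw [h3, schrodinger_apply, hc, hu', hu', hu', hu', hu']
    push_cast
    rw [show (n : ℂ) + (m - 1) = n + m - 1 by ring, show (n : ℂ) + (m + 1) = n + m + 1 by ring,
      show (n : ℂ) - 1 + m = n + m - 1 by ring, show (n : ℂ) + 1 + m = n + m + 1 by ring, h6, h7]
    have hx' : (x : ℂ) = c + 2 * (Complex.exp (θ * Complex.I) +
        Complex.exp (-(θ * Complex.I))) := by
      rw [hexp]
      ring
    rw [hx']
    ring
  have hle : ∀ p : ℤ × ℤ, ‖T u p‖ ≤ 4 * (r⁻¹ - 1) * ‖u p‖ := by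
    rintro ⟨n, m⟩
    have hn1 := hnorm 1
    have hn2 := hnorm (-1)
    have hn3 := hnorm (n + m)
    push_cast at hn1 hn2 hn3
    rw [mul_one] at hn1
    rw [mul_neg_one] at hn2
    have hwn : 0 ≤ w n m := by positivity
    rw [hpt, hu', norm_mul, norm_mul, hn3, one_mul, mul_one, Complex.norm_real,
      Real.norm_of_nonneg hwn]
    have hd : ∀ n' m' : ℤ, n'.natAbs + m'.natAbs ≤ n.natAbs + m.natAbs + 1 →
        n.natAbs + m.natAbs ≤ n'.natAbs + m'.natAbs + 1 →
        ‖((w n' m' - w n m : ℝ) : ℂ)‖ ≤ (r⁻¹ - 1) * w n m := fun n' m' ha hb => by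
      rw [Complex.norm_real]
      exact abs_pow_sub_pow_le h0 h1 ha hb
    refine (norm_add_le _ _).trans ?_
    rw [norm_mul, norm_mul, hn1, hn2, mul_one, mul_one]
    have e1 := hd n (m - 1) (by omega) (by omega)
    have e2 := hd (n - 1) m (by omega) (by omega)
    have e3 := hd n (m + 1) (by omega) (by omega)
    have e4 := hd (n + 1) m (by omega) (by omega)
    have f1 := norm_add_le ((w n (m - 1) - w n m : ℝ) : ℂ) ((w (n - 1) m - w n m : ℝ) : ℂ)
    have f2 := norm_add_le ((w n (m + 1) - w n m : ℝ) : ℂ) ((w (n + 1) m - w n m : ℝ) : ℂ)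
    linarith
  have hK : 0 ≤ 4 * (r⁻¹ - 1) := by
    have := (one_le_inv₀ h0).2 h1.le
    linarith
  have hTu : ‖T u‖ ≤ 4 * (r⁻¹ - 1) * ‖u‖ := by
    refine (sq_le_sq₀ (norm_nonneg _) (by positivity)).1 ?_
    rw [mul_pow, norm_sq_eq, norm_sq_eq, ← tsum_mul_left]
    refine (summable_sq _).tsum_le_tsum (fun p => ?_) ((summable_sq u).mul_left _)
    rw [← mul_pow]
    exact pow_le_pow_left₀ (norm_nonneg _) (hle p) 2
  have hu0 : 0 < ‖u‖ := by
    refine norm_pos_iff.2 fun h => ?_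
    have h2 := hu' 0 0
    rw [h] at h2
    simp [hw] at h2
  nlinarith [hbound u]

end DiscreteSchrodinger

theorem theorem1p3 :
    (∀ (N M : ℕ) (hN : 0 < N) (hM : 0 < M) (q : ℤ → ℤ → ℝ)
        (hq : DiscreteSchrodinger.IsPeriodic N M q),
      MeasureTheory.volume (DiscreteSchrodinger.realSpectrum
        (DiscreteSchrodinger.schrodinger q (hq.isBoundedSeq hN hM))) ≤
          4 * ((N : ENNReal) + (M : ENNReal))) ∧
    (∀ (q : ℤ → ℤ → ℝ) (hq : DiscreteSchrodinger.IsPeriodic 1 1 q),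
      (∃ c : ℝ, ∀ n m : ℤ, q n m = c) →
      MeasureTheory.volume (DiscreteSchrodinger.realSpectrum
        (DiscreteSchrodinger.schrodinger q (hq.isBoundedSeq one_pos one_pos))) =
          4 * (((1 : ℕ) : ENNReal) + ((1 : ℕ) : ENNReal))) := by
  refine ⟨fun N M hN hM q hq => ?_, fun q hq ⟨c, hc⟩ => le_antisymm ?_ ?_⟩
  · have : NeZero N := ⟨hN.ne'⟩
    have : NeZero M := ⟨hM.ne'⟩
    exact DiscreteSchrodinger.volume_realSpectrum_le hq _
  · exact DiscreteSchrodinger.volume_realSpectrum_le hq _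
  · calc (4 * (((1 : ℕ) : ENNReal) + ((1 : ℕ) : ENNReal)))
        = MeasureTheory.volume (Set.Icc (c - 4) (c + 4)) := by
          rw [Real.volume_Icc, show c + 4 - (c - 4) = ((8 : ℕ) : ℝ) by norm_num,
            ENNReal.ofReal_natCast]
          norm_num
      _ ≤ _ := MeasureTheory.measure_mono
          (DiscreteSchrodinger.Icc_subset_realSpectrum _ hc)
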